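/- Let $q$ be a prime power, let $1\le d\le q$, and let $F\in\mathbb{F}_{q^2}[x_0,x_1,x_2,x_3]$ be a nonzero homogeneous polynomial of degree $d$, with zero set $V(F)\subset\mathbb{P}^3$. Let $P\mathcal{U}_2\subset\mathbb{P}^3$ be a degenerate Hermitian surface of rank $3$, that is, the zero set of $x^{T}Hx^{(q)}=\sum_{i,j}h_{ij}x_ix_j^q$, where $H=(h_{ij})$ is a $4\times4$ matrix of rank $3$ over $\mathbb{F}_{q^2}$ with $h_{ij}=h_{ji}^q$ for all $i,j$ (a cone over a non-degenerate Hermitian curve $\mathcal{U}_2$ with vertex an $\mathbb{F}_{q^2}$-rational point $P$). Then $$|P\mathcal{U}_2(\mathbb{F}_{q^2})\cap V(F)(\mathbb{F}_{q^2})|=1+q^2d(q+1)$$ if and only if the set $P\mathcal{U}_2(\mathbb{F}_{q^2})\cap V(F)(\mathbb{F}_{q^2})$ is the union of the sets of $\mathbb{F}_{q^2}$-rational points of $d(q+1)$ distinct lines, each defined over $\mathbb{F}_{q^2}$ and contained in $P\mathcal{U}_2$. -/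

import Mathlib

namespace HermitianCone

/-- The `L`-rational points, in `n`-dimensional projective space, of the projective variety `V(F)`
of a homogeneous polynomial `F` over `K`, where `L` is an extension field of `K`. -/
def zeroLocus {K : Type*} [Field K] {n : ℕ} (F : MvPolynomial (Fin (n + 1)) K)
    (L : Type*) [Field L] [Algebra K L] : Set (Projectivization L (Fin (n + 1) → L)) :=
  {p | MvPolynomial.aeval p.rep F = 0}

/-- For homogeneous `F`, membership in `V(F)` does not depend on the representing vector. -/
theorem mk_mem_zeroLocus_iff {K : Type*} [Field K] {n d : ℕ} {F : MvPolynomial (Fin (n + 1)) K}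
    (hF : F.IsHomogeneous d) (L : Type*) [Field L] [Algebra K L]
    (v : Fin (n + 1) → L) (hv : v ≠ 0) :
    Projectivization.mk L v hv ∈ zeroLocus F L ↔ MvPolynomial.aeval v F = 0 := by
  obtain ⟨a, ha⟩ := Projectivization.exists_smul_eq_mk_rep L v hv
  have key : MvPolynomial.aeval (Projectivization.mk L v hv).rep F
      = (a : L) ^ d * MvPolynomial.aeval v F := by
    rw [← ha, MvPolynomial.aeval_def, MvPolynomial.aeval_def, MvPolynomial.eval₂_eq,
      MvPolynomial.eval₂_eq, Finset.mul_sum]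
    refine Finset.sum_congr rfl fun m hm => ?_
    have hdeg : ∑ i ∈ m.support, m i = d :=
      (hF.degree_eq_sum_deg_support hm).symm
    simp only [Units.smul_def, Pi.smul_apply, smul_eq_mul, mul_pow, Finset.prod_mul_distrib,
      Finset.prod_pow_eq_pow_sum, hdeg]
    ring
  simp [zeroLocus, key]

/-- The `L`-rational points of the projective linear subspace, defined over `K`, that is given by
the linear subspace `W` of `K ^ (n + 1)`. -/
def linearPoints {K : Type*} [Field K] {n : ℕ} (W : Submodule K (Fin (n + 1) → K))
    (L : Type*) [Field L] [Algebra K L] : Set (Projectivization L (Fin (n + 1) → L)) :=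
  {p | p.rep ∈ Submodule.span L
    ((fun (w : Fin (n + 1) → K) (i : Fin (n + 1)) => algebraMap K L (w i)) '' (W : Set _))}

theorem mem_linearPoints_self_iff {K : Type*} [Field K] {n : ℕ}
    (W : Submodule K (Fin (n + 1) → K)) (p : Projectivization K (Fin (n + 1) → K)) :
    p ∈ linearPoints W K ↔ p.rep ∈ W := by
  simp [linearPoints]

/-- A `K`-line of projective `n`-space contained in the variety `V(F)`. The line is given by a
two-dimensional subspace of `K ^ (n + 1)`, and containment is containment of varieties, that is, of
points over an algebraic closure of `K`. -/
def IsLineOf {K : Type*} [Field K] {n : ℕ} (F : MvPolynomial (Fin (n + 1)) K)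
    (W : Submodule K (Fin (n + 1) → K)) : Prop :=
  Module.finrank K W = 2 ∧
    linearPoints W (AlgebraicClosure K) ⊆ zeroLocus F (AlgebraicClosure K)

/-- A Hermitian matrix over the field with `q ^ 2` elements: `H ≠ 0` and `Hᵀ = H^(q)`. -/
def IsHermitianMatrix {K : Type*} [Field K] {n : ℕ} (q : ℕ)
    (H : Matrix (Fin (n + 1)) (Fin (n + 1)) K) : Prop :=
  H ≠ 0 ∧ H.transpose = H.map (fun a => a ^ q)

/-- The polynomial `xᵀ H x^(q)`, whose zero set is the Hermitian variety of `H`. -/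
noncomputable def hermitianPoly {K : Type*} [Field K] {n : ℕ} (q : ℕ)
    (H : Matrix (Fin (n + 1)) (Fin (n + 1)) K) : MvPolynomial (Fin (n + 1)) K :=
  ∑ i, ∑ j, MvPolynomial.C (H i j) * MvPolynomial.X i * MvPolynomial.X j ^ q

end HermitianCone

/-! Choose coordinates `t, y, x, z` with the vertex at `t`, in which the cone is `y z^q + y^q z + β
x^(q+1) + γ z^(q+1) = 0`. Regard `F` as a polynomial in `t` of degree `k`, whose leading coefficient
`G` is a plane form of degree `d - k`. A generator of the cone over a point of the Hermitian curve
carries, off the vertex, at most `q^2` points of `V(F)` if `G` vanishes there, and at most `k`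
otherwise. The curve has at most `q^3 + 1` rational points, and `G` vanishes at no more than `(d -
k)(q + 1)` of them (`card_inter_hermitianCurve_le`). Summing, the extremal count forces `k = 0`
(`natDegree_eq_zero_of_count`): `F` does not involve `t`, so `V(F)` is a cone with the same vertex
and the intersection is a union of generators.

The plane bound is a footprint argument: give `x` and `y` the weights `q` and `q + 1`, their pole
orders at infinity. The leading monomial of `G` then limits which monomials are needed to span the
functions on the common zeros.

For the converse, every line on the cone passes through the vertex (`mem_of_isLineOf`), so distinct
lines share only that point, and `N ≥ 1` lines cover `1 + q^2 N` points. The same count shows that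
the union found in the extremal case has exactly `d(q + 1)` lines. -/

namespace HermitianCone
open Submodule

/-! ### Weights on the Hermitian curve and the footprint bound -/

/-- The span of the monomials `X ^ i * Y ^ j` of weight `q * i + (q + 1) * j` less than `n`. -/
def weightLT (K : Type*) {A : Type*} [Field K] [CommRing A] [Algebra K A] (q : ℕ) (X Y : A)
    (n : ℕ) : Submodule K A :=
  span K {z | ∃ i j, q * i + (q + 1) * j < n ∧ z = X ^ i * Y ^ j}

section Weight

variable {K A : Type*} [Field K] [CommRing A] [Algebra K A] {q : ℕ} {X Y : A}

theorem monomial_mem_weightLT {n i j : ℕ} (h : q * i + (q + 1) * j < n) :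
    X ^ i * Y ^ j ∈ weightLT K q X Y n :=
  subset_span ⟨i, j, h, rfl⟩

theorem monomial_mul_mem_weightLT {n m : ℕ} (c d : ℕ) (hm : n + (q * c + (q + 1) * d) ≤ m)
    {z : A} (hz : z ∈ weightLT K q X Y n) : X ^ c * Y ^ d * z ∈ weightLT K q X Y m := by
  induction hz using span_induction with
  | mem z hz =>
    obtain ⟨i, j, h, rfl⟩ := hz
    have : X ^ c * Y ^ d * (X ^ i * Y ^ j) = X ^ (c + i) * Y ^ (d + j) := by ring
    rw [this]
    apply monomial_mem_weightLT
    have : q * (c + i) + (q + 1) * (d + j)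
        = q * i + (q + 1) * j + (q * c + (q + 1) * d) := by ring
    omega
  | zero => simp
  | add x y _ _ hx hy => rw [mul_add]; exact add_mem hx hy
  | smul k x _ hx => rw [mul_smul_comm]; exact smul_mem _ _ hx

/-- Any monomial outside the footprint can be rewritten in lower weight. The curve equation
exchanges `Y^q` and `X^(q+1)`, both of weight `q(q+1)`, up to lower terms, and `hlead` lowers the
weight of every multiple of `X^a Y^b`. -/
theorem weightLT_le_footprint {a b : ℕ} {β γ : K} (hβ : β ≠ 0) (hq : 2 ≤ q) (hb : b ≤ q)
    (hcurve : Y ^ q = -(Y + β • X ^ (q + 1) + γ • 1))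
    (hlead : X ^ a * Y ^ b ∈ weightLT K q X Y (q * a + (q + 1) * b)) (n : ℕ) :
    weightLT K q X Y n ≤ span K
      {z | ∃ i j, ((j < b ∧ i < a + q + 1) ∨ (j < q ∧ i < a)) ∧ z = X ^ i * Y ^ j} := by
  induction n with
  | zero =>
    refine span_le.2 ?_
    rintro _ ⟨i, j, h, rfl⟩
    omega
  | succ n ih =>
    have lead : ∀ i j, q * i + (q + 1) * j = n → a ≤ i → b ≤ j →
        X ^ i * Y ^ j ∈ weightLT K q X Y n := by
      intro i j h hi hj
      obtain ⟨i, rfl⟩ := Nat.exists_eq_add_of_le' hi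
      obtain ⟨j, rfl⟩ := Nat.exists_eq_add_of_le' hj
      have e : X ^ (i + a) * Y ^ (j + b) = X ^ i * Y ^ j * (X ^ a * Y ^ b) := by ring
      rw [e]
      refine monomial_mul_mem_weightLT i j ?_ hlead
      rw [← h]
      exact le_of_eq (by ring)
    have red : ∀ j i, j < q → q * i + (q + 1) * j = n → X ^ i * Y ^ j ∈ span K
      {z | ∃ i j, ((j < b ∧ i < a + q + 1) ∨ (j < q ∧ i < a)) ∧ z = X ^ i * Y ^ j} := by
      intro j i hj h
      by_cases h1 : (j < b ∧ i < a + q + 1) ∨ (j < q ∧ i < a)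
      · exact subset_span ⟨i, j, h1, rfl⟩
      apply ih
      by_cases h2 : b ≤ j
      · exact lead i j h (by omega) h2
      -- Here `j < b` and `a + q + 1 ≤ i`. Trading `X^(q+1)` for `Y^q` keeps the weight and yields a
      -- multiple of `X^a Y^b`, because `b ≤ q`.
      obtain ⟨i, rfl⟩ : ∃ i', i = i' + (q + 1) := Nat.exists_eq_add_of_le' (by omega)
      have e : X ^ (i + (q + 1)) * Y ^ j = -β⁻¹ • (X ^ i * Y ^ (j + q) + X ^ i * Y ^ (j + 1)
          + γ • (X ^ i * Y ^ j)) := by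
        have : X ^ i * Y ^ (j + q) + X ^ i * Y ^ (j + 1) + γ • (X ^ i * Y ^ j)
            = -β • (X ^ (i + (q + 1)) * Y ^ j) := by
          rw [pow_add Y j q, hcurve]
          simp only [Algebra.smul_def, map_neg]
          ring
        rw [this, smul_smul, neg_mul_neg, inv_mul_cancel₀ hβ, one_smul]
      have hw : q * (i + (q + 1)) + (q + 1) * j = q * i + (q + 1) * j + q * (q + 1) := by ring
      have hqq : 2 * (q + 1) ≤ q * (q + 1) := Nat.mul_le_mul_right _ hq
      rw [e]
      refine smul_mem _ _ (add_mem (add_mem ?_ ?_) (smul_mem _ _ ?_))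
      · refine lead _ _ ?_ (by omega) ?_
        · rw [← h]; ring
        · by_contra hlt
          omega
      · apply monomial_mem_weightLT
        rw [mul_add (q + 1) j 1]
        omega
      · apply monomial_mem_weightLT
        omega
    refine span_le.2 ?_
    rintro _ ⟨i, j, h, rfl⟩
    induction j using Nat.strong_induction_on generalizing i with
    | _ j ihj =>
    rcases Nat.lt_or_ge (q * i + (q + 1) * j) n with h3 | h3
    · exact ih (monomial_mem_weightLT h3)
    by_cases hj : j < q
    · exact red j i hj (by omega)
    obtain ⟨j, rfl⟩ : ∃ j', j = j' + q := Nat.exists_eq_add_of_le' (by omega)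
    -- Replacing `Y^q` lowers the exponent of `Y` in every term without raising the weight; `q ≥ 2`
    -- makes `j + 1 < j + q`.
    have e : X ^ i * Y ^ (j + q) = -(X ^ i * Y ^ (j + 1) + β • (X ^ (i + (q + 1)) * Y ^ j)
        + γ • (X ^ i * Y ^ j)) := by
      rw [pow_add Y j q, hcurve]
      simp only [Algebra.smul_def]
      ring
    have hw : q * (i + (q + 1)) + (q + 1) * j = q * i + (q + 1) * (j + q) := by ring
    have hqq : 2 * (q + 1) ≤ q * (q + 1) := Nat.mul_le_mul_right _ hq
    have hw' : (q + 1) * (j + q) = (q + 1) * j + q * (q + 1) := by ring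
    have hw'' : (q + 1) * (j + 1) = (q + 1) * j + (q + 1) := by ring
    rw [e]
    refine neg_mem (add_mem (add_mem ?_ (smul_mem _ _ ?_)) (smul_mem _ _ ?_))
    · exact ihj _ (by omega) _ (by omega)
    · exact ihj _ (by omega) _ (by omega)
    · exact ihj _ (by omega) _ (by omega)

/-- The footprint consists of two rectangles with `(a + q + 1) b + a (q - b) = q a + (q + 1) b`
monomials, which is exactly the weight of `X^a Y^b`. -/
theorem finrank_le_weight {a b : ℕ} {β γ : K} (hβ : β ≠ 0) (hq : 2 ≤ q) (hb : b ≤ q)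
    (hcurve : Y ^ q = -(Y + β • X ^ (q + 1) + γ • 1))
    (hlead : X ^ a * Y ^ b ∈ weightLT K q X Y (q * a + (q + 1) * b))
    (hspan : span K (Set.range fun m : ℕ × ℕ => X ^ m.1 * Y ^ m.2) = ⊤) :
    Module.finrank K A ≤ q * a + (q + 1) * b := by
  classical
  let s : Finset (ℕ × ℕ) :=
    Finset.range (a + q + 1) ×ˢ Finset.range b ∪ Finset.range a ×ˢ Finset.Ico b q
  let t : Finset A := s.image fun m => X ^ m.1 * Y ^ m.2
  have ht : span K (t : Set A) = ⊤ := by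
    rw [eq_top_iff, ← hspan, span_le]
    rintro _ ⟨⟨i, j⟩, rfl⟩
    have := weightLT_le_footprint hβ hq hb hcurve hlead _
      (monomial_mem_weightLT (K := K) (X := X) (Y := Y) (Nat.lt_succ_self (q * i + (q + 1) * j)))
    refine span_mono ?_ this
    rintro _ ⟨i, j, h, rfl⟩
    simp only [t, s, Finset.coe_image, Set.mem_image, Finset.mem_coe, Finset.mem_union,
      Finset.mem_product, Finset.mem_range, Finset.mem_Ico]
    refine ⟨(i, j), ?_, rfl⟩
    dsimp only
    omega
  calc Module.finrank K A = Module.finrank K (span K (t : Set A)) := by rw [ht, finrank_top]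
    _ ≤ t.card := finrank_span_finset_le_card t
    _ ≤ s.card := Finset.card_image_le
    _ ≤ (a + q + 1) * b + a * (q - b) := by
      refine (Finset.card_union_le _ _).trans ?_
      simp
    _ = q * a + (q + 1) * b := by
      obtain ⟨c, rfl⟩ := Nat.exists_eq_add_of_le hb
      rw [Nat.add_sub_cancel_left]
      ring

end Weight

/-- Over a finite field every function on `K^2` is polynomial; a function on `Z` is first extended
by zero. -/
theorem span_monomials_eq_top {K : Type*} [Field K] [Finite K] (Z : Set (K × K)) :
    span K (Set.range fun m : ℕ × ℕ =>
      (fun z : Z => z.1.1) ^ m.1 * (fun z : Z => z.1.2) ^ m.2) = ⊤ := by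
  classical
  have := Fintype.ofFinite K
  rw [eq_top_iff]
  intro f _
  have h : (fun s : Fin 2 → K => if h : (s 0, s 1) ∈ Z then f ⟨_, h⟩ else 0) ∈
      (MvPolynomial.restrictDegree (Fin 2) K (Fintype.card K - 1)).map
        (MvPolynomial.evalₗ K (Fin 2)) := by
    rw [MvPolynomial.map_restrict_dom_evalₗ]; trivial
  obtain ⟨p, -, hp⟩ := h
  have hf : f = ∑ m ∈ p.support, p.coeff m •
      ((fun z : Z => z.1.1) ^ (m 0) * (fun z : Z => z.1.2) ^ (m 1)) := by
    funext z
    have h1 := congr_fun hp ![z.1.1, z.1.2]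
    simp only [MvPolynomial.evalₗ_apply, Matrix.cons_val_zero, Matrix.cons_val_one, Prod.mk.eta,
      Subtype.coe_prop, dite_true, Subtype.coe_eta] at h1
    rw [← h1, MvPolynomial.eval_eq']
    simp [Finset.sum_apply, Fin.prod_univ_two]
  rw [hf]
  exact sum_mem fun m _ => smul_mem _ _ (subset_span ⟨(m 0, m 1), rfl⟩)

/-- The weight equals `q (m 0 + m 1) + m 0`, and the degree bound `e ≤ q` keeps `m 0` too small for
a carry between different values of `m 0 + m 1`. Hence a form of degree `e` has a unique monomial of
top weight. -/
theorem weight_injOn {q e : ℕ} (heq : e ≤ q) {m n : Fin 3 →₀ ℕ} (hm : m 0 + m 1 + m 2 = e)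
    (hn : n 0 + n 1 + n 2 = e) (h : q * m 1 + (q + 1) * m 0 = q * n 1 + (q + 1) * n 0) :
    m = n := by
  have key : ∀ m n : Fin 3 →₀ ℕ, m 0 + m 1 + m 2 = e → n 0 + n 1 + n 2 = e →
      q * m 1 + (q + 1) * m 0 = q * n 1 + (q + 1) * n 0 → m 0 + m 1 ≤ n 0 + n 1 := by
    intro m n hm hn h
    by_contra hlt
    push Not at hlt
    have h1 : q * (n 0 + n 1 + 1) ≤ q * (m 0 + m 1) := Nat.mul_le_mul_left _ hlt
    have h2 : q * (m 0 + m 1) + m 0 = q * (n 0 + n 1) + n 0 := by linarith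
    have h3 : q * (n 0 + n 1 + 1) = q * (n 0 + n 1) + q := by ring
    omega
  have h1 := le_antisymm (key m n hm hn h) (key n m hn hm h.symm)
  have h2 : q * (m 0 + m 1) + m 0 = q * (n 0 + n 1) + n 0 := by linarith
  rw [h1] at h2
  ext i
  fin_cases i <;> simp <;> omega

/-- A plane curve of degree `e ≤ q` meets the Hermitian curve `y + y ^ q + β x ^ (q + 1) + γ = 0`
in at most `e * (q + 1)` rational points, the point at infinity included. -/
theorem card_inter_hermitianCurve_le {K : Type*} [Field K] [Finite K] {q e : ℕ} (hq : 2 ≤ q)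
    (heq : e ≤ q) {β γ : K} (hβ : β ≠ 0) {G : MvPolynomial (Fin 3) K} (hG0 : G ≠ 0)
    (hG : G.IsHomogeneous e) [Decidable (MvPolynomial.eval ![1, 0, 0] G = 0)] :
    {z : K × K | z.2 + z.2 ^ q + β * z.1 ^ (q + 1) + γ = 0 ∧
      MvPolynomial.eval ![z.2, z.1, 1] G = 0}.ncard
      + (if MvPolynomial.eval ![1, 0, 0] G = 0 then 1 else 0) ≤ e * (q + 1) := by
  classical
  have := Fintype.ofFinite K
  set Z := {z : K × K | z.2 + z.2 ^ q + β * z.1 ^ (q + 1) + γ = 0 ∧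
      MvPolynomial.eval ![z.2, z.1, 1] G = 0} with hZ
  have hdeg : ∀ m ∈ G.support, m 0 + m 1 + m 2 = e := by
    intro m hm
    have := hG (MvPolynomial.mem_support_iff.1 hm)
    rw [Finsupp.weight_apply, Finsupp.sum_fintype _ _ (by simp)] at this
    simpa [Fin.sum_univ_three] using this
  obtain ⟨m, hm, hmax⟩ := Finset.exists_max_image G.support (fun m => q * m 1 + (q + 1) * m 0)
    (MvPolynomial.support_nonempty.2 hG0)
  have hmd := hdeg m hm
  have hc : G.coeff m ≠ 0 := MvPolynomial.mem_support_iff.1 hm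
  let X : Z → K := fun z => z.1.1
  let Y : Z → K := fun z => z.1.2
  have hcurve : Y ^ q = -(Y + β • X ^ (q + 1) + γ • 1) := by
    funext z
    have := z.2.1
    simp only [X, Y, Pi.pow_apply, Pi.neg_apply, Pi.add_apply, Pi.smul_apply, Pi.one_apply,
      smul_eq_mul, mul_one]
    linear_combination this
  have hsum : ∑ n ∈ G.support, G.coeff n • (X ^ (n 1) * Y ^ (n 0)) = 0 := by
    funext z
    have := z.2.2
    rw [MvPolynomial.eval_eq'] at this
    simpa [Finset.sum_apply, Fin.prod_univ_three, X, Y, mul_comm] using this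
  have hlead : X ^ (m 1) * Y ^ (m 0) ∈ weightLT K q X Y (q * m 1 + (q + 1) * m 0) := by
    rw [← Finset.add_sum_erase _ _ hm] at hsum
    have h1 : X ^ (m 1) * Y ^ (m 0) = -(G.coeff m)⁻¹ •
        ∑ n ∈ G.support.erase m, G.coeff n • (X ^ (n 1) * Y ^ (n 0)) := by
      rw [← neg_eq_of_add_eq_zero_right hsum, neg_smul_neg, smul_smul, inv_mul_cancel₀ hc,
        one_smul]
    rw [h1]
    refine smul_mem _ _ (sum_mem fun n hn => smul_mem _ _ (monomial_mem_weightLT ?_))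
    obtain ⟨hne, hn⟩ := Finset.mem_erase.1 hn
    refine lt_of_le_of_ne (hmax n hn) fun h => hne ?_
    exact weight_injOn heq (hdeg n hn) hmd h
  have hcard := finrank_le_weight hβ hq (by omega) hcurve hlead (span_monomials_eq_top Z)
  rw [Module.finrank_fintype_fun_eq_card, ← Nat.card_eq_fintype_card, Nat.card_coe_set_eq] at hcard
  have h1 : q * m 1 + (q + 1) * m 0 = q * (m 0 + m 1) + m 0 := by ring
  have h2 : q * (m 0 + m 1) ≤ q * e := Nat.mul_le_mul_left _ (by omega)
  have h3 : e * (q + 1) = q * e + e := by ring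
  split_ifs with h
  -- Passing through the point at infinity kills the coefficient of `y^e`, so the leading weight `q
  -- (m 0 + m 1) + m 0` drops by at least one, which pays for the extra point.
  · have hlt : m 0 ≠ e := by
      intro hme
      apply hc
      rw [MvPolynomial.eval_eq', Finset.sum_eq_single m] at h
      · have h1 : m 1 = 0 := by omega
        have h2 : m 2 = 0 := by omega
        simpa [Fin.prod_univ_three, h1, h2] using h
      · intro n hn hne
        have : n 1 ≠ 0 ∨ n 2 ≠ 0 := by
          by_contra hcon
          push Not at hcon
          apply hne
          have := hdeg n hn
          ext i
          fin_cases i <;> simp <;> omega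
        rcases this with h | h <;> simp [Fin.prod_univ_three, h]
      · exact fun h => absurd hm h
    omega
  · omega

/-! ### Fibre counts and elimination of the vertex coordinate -/

theorem card_pow_add_eq_zero_le {K : Type*} [Field K] [Fintype K] [DecidableEq K] {q : ℕ}
    (hq : 2 ≤ q) (c : K) : (Finset.univ.filter fun y : K => y + y ^ q + c = 0).card ≤ q := by
  let p : Polynomial K := Polynomial.X ^ q + (Polynomial.X + Polynomial.C c)
  have hlt : (Polynomial.X + Polynomial.C c).degree < (q : WithBot ℕ) := by
    rw [Polynomial.degree_X_add_C]; exact_mod_cast hq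
  have hdeg : p.natDegree ≤ q := by
    refine Polynomial.natDegree_add_le_of_degree_le (Polynomial.natDegree_X_pow_le q) ?_
    exact (Polynomial.natDegree_X_add_C c).le.trans (by omega)
  have hp : p ≠ 0 := (Polynomial.monic_X_pow_add hlt).ne_zero
  calc _ ≤ p.roots.toFinset.card := Finset.card_le_card fun y hy => by
        rw [Multiset.mem_toFinset, Polynomial.mem_roots hp, Polynomial.IsRoot.def]
        have := (Finset.mem_filter.1 hy).2
        simp only [p, Polynomial.eval_add, Polynomial.eval_pow, Polynomial.eval_X,
          Polynomial.eval_C]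
        linear_combination this
    _ ≤ p.roots.card := Multiset.toFinset_card_le _
    _ ≤ q := p.card_roots'.trans hdeg

theorem card_fiber_le {K : Type*} [Field K] [Fintype K] [DecidableEq K]
    (F : MvPolynomial (Fin (3 + 1)) K) (s : Fin 3 → K)
    (h : MvPolynomial.eval s (MvPolynomial.finSuccEquiv K 3 F).leadingCoeff ≠ 0) :
    (Finset.univ.filter fun t : K => MvPolynomial.eval (Fin.cons t s) F = 0).card ≤
      (MvPolynomial.finSuccEquiv K 3 F).natDegree := by
  set p := (MvPolynomial.finSuccEquiv K 3 F).map (MvPolynomial.eval s) with hp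
  have hp0 : p ≠ 0 := by
    intro h0
    apply h
    have := congr_arg (fun r : Polynomial K =>
      r.coeff (MvPolynomial.finSuccEquiv K 3 F).natDegree) h0
    simpa [hp, Polynomial.coeff_map] using this
  calc _ ≤ p.roots.toFinset.card := Finset.card_le_card fun y hy => by
        rw [Multiset.mem_toFinset, Polynomial.mem_roots hp0, Polynomial.IsRoot.def, hp,
          ← MvPolynomial.eval_eq_eval_mv_eval']
        exact (Finset.mem_filter.1 hy).2
    _ ≤ p.roots.card := Multiset.toFinset_card_le _
    _ ≤ p.natDegree := p.card_roots'
    _ ≤ _ := Polynomial.natDegree_map_le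

/-- Since `k ≤ q^2`, the bound on `N` increases with `n`. Inserting the largest `n` and `u` leaves
it short of `1 + q^2 d (q + 1)` by `k (d - k)(q + 1) + k (q^2 - 1)`, which is positive unless `k =
0`. -/
theorem natDegree_eq_zero_of_count {q d k n u N : ℕ} (hq : 2 ≤ q) (hdq : d ≤ q) (hk : k ≤ d)
    (hn : n ≤ (d - k) * (q + 1)) (hu : u ≤ q ^ 3 + 1) (hnu : n ≤ u)
    (hN : N ≤ 1 + n * q ^ 2 + (u - n) * k) (hN' : 1 + q ^ 2 * (d * (q + 1)) ≤ N) : k = 0 := by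
  by_contra h0
  have hkd : (k : ℤ) ≤ d := by exact_mod_cast hk
  zify [hk, hnu] at *
  have hk1 : (1 : ℤ) ≤ k := by
    have : (0 : ℤ) ≤ k := by positivity
    omega
  have h1 : (k : ℤ) ≤ q ^ 2 := by nlinarith
  have h2 : (n : ℤ) * (q ^ 2 - k) ≤ (d - k) * (q + 1) * (q ^ 2 - k) :=
    mul_le_mul_of_nonneg_right hn (by linarith)
  have h3 : (u : ℤ) * k ≤ (q ^ 3 + 1) * k := mul_le_mul_of_nonneg_right hu (by linarith)
  have h4 : (0 : ℤ) ≤ k * (d - k) * (q + 1) := by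
    have : (0 : ℤ) ≤ d - k := by linarith
    positivity
  have h5 : (0 : ℤ) < k * (q ^ 2 - 1) := by
    apply mul_pos (by linarith); nlinarith
  nlinarith

/-- If the form `F` of degree at most `q` has at least the maximal number of zeros on the cone over
`y + y ^ q + β x ^ (q + 1) + γ = 0`, then `F` does not involve the vertex coordinate. -/
theorem eval_cons_eq_of_card_le {K : Type*} [Field K] [Fintype K] [DecidableEq K] {q d : ℕ}
    (hq : 2 ≤ q)
    (hK : Fintype.card K = q ^ 2) (hdq : d ≤ q) {β γ : K} (hβ : β ≠ 0)
    {F : MvPolynomial (Fin (3 + 1)) K} (hF0 : F ≠ 0) (hF : F.IsHomogeneous d)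
    (hcard : 1 + q ^ 2 * (d * (q + 1)) ≤
      1 + (Finset.univ.filter fun z : K × K × K => z.2.2 + z.2.2 ^ q + β * z.2.1 ^ (q + 1) + γ = 0
        ∧ MvPolynomial.eval (Fin.cons z.1 ![z.2.2, z.2.1, 1]) F = 0).card
      + (Finset.univ.filter fun t : K =>
          MvPolynomial.eval (Fin.cons t ![1, 0, 0]) F = 0).card) (t : K) (s : Fin 3 → K) :
    MvPolynomial.eval (Fin.cons t s) F = MvPolynomial.eval (Fin.cons 0 s) F := by
  set P := MvPolynomial.finSuccEquiv K 3 F with hP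
  have hP0 : P ≠ 0 := by simpa [hP] using hF0
  set k := P.natDegree with hk
  have hG0 : P.leadingCoeff ≠ 0 := Polynomial.leadingCoeff_ne_zero.2 hP0
  have hkd : k ≤ d := by
    rw [hk, hP, MvPolynomial.natDegree_finSuccEquiv]
    exact (MvPolynomial.degreeOf_le_totalDegree F 0).trans hF.totalDegree_le
  have hG : P.leadingCoeff.IsHomogeneous (d - k) :=
    hF.finSuccEquiv_coeff_isHomogeneous k (d - k) (by omega)
  set G := P.leadingCoeff
  have hbez := card_inter_hermitianCurve_le hq ((Nat.sub_le d k).trans hdq) (γ := γ) hβ hG0 hG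
  let U := Finset.univ.filter fun z : K × K => z.2 + z.2 ^ q + β * z.1 ^ (q + 1) + γ = 0
  let V := U.filter fun z => MvPolynomial.eval ![z.2, z.1, 1] G = 0
  have hVset : {z : K × K | z.2 + z.2 ^ q + β * z.1 ^ (q + 1) + γ = 0 ∧
      MvPolynomial.eval ![z.2, z.1, 1] G = 0} = (V : Set (K × K)) := by
    ext z; simp [V, U]
  rw [hVset, Set.ncard_coe_finset] at hbez
  have hfib : ∀ s : Fin 3 → K,
      (Finset.univ.filter fun t : K => MvPolynomial.eval (Fin.cons t s) F = 0).card ≤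
        if MvPolynomial.eval s G = 0 then q ^ 2 else k := by
    intro s
    split_ifs with h
    · rw [← hK]; exact Finset.card_le_univ _
    · exact card_fiber_le F s h
  have hU : U.card ≤ q ^ 3 := by
    calc U.card ≤ (Finset.univ.biUnion fun x : K => (Finset.univ.filter fun y : K =>
            y + y ^ q + (β * x ^ (q + 1) + γ) = 0).image fun y => (x, y)).card := by
          refine Finset.card_le_card fun z hz => ?_
          simp only [Finset.mem_biUnion, Finset.mem_image, Finset.mem_filter, Finset.mem_univ,
            true_and, U] at hz ⊢
          exact ⟨z.1, z.2, by rw [← hz]; ring, rfl⟩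
      _ ≤ ∑ x : K, q := Finset.card_biUnion_le.trans (Finset.sum_le_sum fun x _ =>
          Finset.card_image_le.trans (card_pow_add_eq_zero_le hq _))
      _ = q ^ 3 := by rw [Finset.sum_const, Finset.card_univ, hK, smul_eq_mul]; ring
  have hA : (Finset.univ.filter fun z : K × K × K =>
      z.2.2 + z.2.2 ^ q + β * z.2.1 ^ (q + 1) + γ = 0
        ∧ MvPolynomial.eval (Fin.cons z.1 ![z.2.2, z.2.1, 1]) F = 0).card
      ≤ V.card * q ^ 2 + (U.card - V.card) * k := by
    calc _ ≤ (U.biUnion fun z => (Finset.univ.filter fun t : K =>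
            MvPolynomial.eval (Fin.cons t ![z.2, z.1, 1]) F = 0).image fun t => (t, z)).card := by
          refine Finset.card_le_card fun z hz => ?_
          simp only [Finset.mem_biUnion, Finset.mem_image, Finset.mem_filter, Finset.mem_univ,
            true_and, U] at hz ⊢
          exact ⟨z.2, hz.1, z.1, hz.2, rfl⟩
      _ ≤ ∑ z ∈ U, if MvPolynomial.eval ![z.2, z.1, 1] G = 0 then q ^ 2 else k :=
          Finset.card_biUnion_le.trans (Finset.sum_le_sum fun z _ =>
            Finset.card_image_le.trans (hfib _))
      _ = V.card * q ^ 2 + (U.card - V.card) * k := by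
          rw [Finset.sum_ite, Finset.sum_const, Finset.sum_const, smul_eq_mul, smul_eq_mul,
            ← Finset.card_filter_add_card_filter_not (s := U)
              (fun z => MvPolynomial.eval ![z.2, z.1, 1] G = 0)]
          simp [V]
  have hVU : V.card ≤ U.card := Finset.card_filter_le _ _
  have hk0 : k = 0 := by
    -- The curve's point at infinity is treated apart from the affine points in `U`, hence `u =
    -- U.card + 1`.
    have hinf := hfib ![1, 0, 0]
    refine natDegree_eq_zero_of_count (u := U.card + 1) hq hdq hkd hbez (by omega) ?_ ?_ hcard
    · split_ifs <;> omega
    · split_ifs at hinf ⊢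
      · rw [Nat.add_sub_add_right, add_mul, one_mul]
        omega
      · rw [add_zero, Nat.sub_add_comm hVU, add_mul (U.card - V.card), one_mul]
        omega
  rw [MvPolynomial.eval_eq_eval_mv_eval', MvPolynomial.eval_eq_eval_mv_eval', ← hP,
    Polynomial.eq_C_of_natDegree_eq_zero hk0]
  simp

/-! ### The sesquilinear form, its radical and its normal form -/

/-- The sesquilinear form `xᵀ H y^(q)`. -/
def sesqForm {L : Type*} [Field L] {n : ℕ} (q : ℕ) (H : Matrix (Fin n) (Fin n) L)
    (x y : Fin n → L) : L :=
  ∑ i, ∑ j, H i j * x i * y j ^ q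

/-- As `q` divides the prime power `q^2 = |K|`, it is a power of the characteristic, so `a ↦ a^q` is
an iterated Frobenius on every extension. -/
theorem exists_powHom {K : Type*} [Field K] [Finite K] {q : ℕ} (hq : Nat.card K = q ^ 2)
    (L : Type*) [Field L] [Algebra K L] : ∃ σ : L →+* L, ∀ a, σ a = a ^ q := by
  have := Fintype.ofFinite K
  obtain ⟨p, hp⟩ := CharP.exists K
  obtain ⟨n, hprime, hn⟩ := FiniteField.card K p
  rw [← Nat.card_eq_fintype_card, hq] at hn
  obtain ⟨k, -, hk⟩ := (Nat.dvd_prime_pow hprime).1 (hn ▸ dvd_pow_self q two_ne_zero)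
  have : CharP L p := charP_of_injective_algebraMap (algebraMap K L).injective p
  have : ExpChar L p := ExpChar.prime hprime
  exact ⟨iterateFrobenius L p k, fun a => by rw [iterateFrobenius_def, hk]⟩

section Form

variable {L : Type*} [Field L] {n q : ℕ} {H : Matrix (Fin n) (Fin n) L}

theorem sesqForm_add_left (x x' y : Fin n → L) :
    sesqForm q H (x + x') y = sesqForm q H x y + sesqForm q H x' y := by
  simp only [sesqForm, ← Finset.sum_add_distrib, Pi.add_apply]
  exact Finset.sum_congr rfl fun i _ => Finset.sum_congr rfl fun j _ => by ring

theorem sesqForm_smul_left (c : L) (x y : Fin n → L) :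
    sesqForm q H (c • x) y = c * sesqForm q H x y := by
  simp only [sesqForm, Finset.mul_sum, Pi.smul_apply, smul_eq_mul]
  exact Finset.sum_congr rfl fun i _ => Finset.sum_congr rfl fun j _ => by ring

theorem sesqForm_smul_right (c : L) (x y : Fin n → L) :
    sesqForm q H x (c • y) = c ^ q * sesqForm q H x y := by
  simp only [sesqForm, Finset.mul_sum, Pi.smul_apply, smul_eq_mul]
  exact Finset.sum_congr rfl fun i _ => Finset.sum_congr rfl fun j _ => by ring

theorem sesqForm_add_right {σ : L →+* L} (hσ : ∀ a, σ a = a ^ q) (x y y' : Fin n → L) :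
    sesqForm q H x (y + y') = sesqForm q H x y + sesqForm q H x y' := by
  simp only [sesqForm, ← Finset.sum_add_distrib, Pi.add_apply, ← hσ, map_add]
  exact Finset.sum_congr rfl fun i _ => Finset.sum_congr rfl fun j _ => by ring

theorem sesqForm_swap {σ : L →+* L} (hσ : ∀ a, σ a = a ^ q) (hσσ : ∀ a, σ (σ a) = a)
    (hH : H.transpose = H.map (fun a => a ^ q)) (x y : Fin n → L) :
    sesqForm q H y x = sesqForm q H x y ^ q := by
  rw [← hσ, sesqForm, sesqForm, Finset.sum_comm, map_sum]
  refine Finset.sum_congr rfl fun i _ => ?_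
  rw [map_sum]
  refine Finset.sum_congr rfl fun j _ => ?_
  have h : H j i = H i j ^ q := congr_fun (congr_fun hH i) j
  rw [map_mul, map_mul, ← hσ (y j), hσσ, h, ← hσ, ← hσ]
  ring

theorem sesqForm_eq_dotProduct (x y : Fin n → L) :
    sesqForm q H x y = x ⬝ᵥ H.mulVec (fun j => y j ^ q) := by
  simp only [sesqForm, dotProduct, Matrix.mulVec, Finset.mul_sum]
  exact Finset.sum_congr rfl fun i _ => Finset.sum_congr rfl fun j _ => by ring

theorem forall_sesqForm_eq_zero_iff (y : Fin n → L) :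
    (∀ x, sesqForm q H x y = 0) ↔ H.mulVec (fun j => y j ^ q) = 0 := by
  simp only [sesqForm_eq_dotProduct]
  constructor
  · intro h
    funext i
    simpa using h (Pi.single i 1)
  · intro h x
    rw [h, dotProduct_zero]

/-- The kernel of `H` is one-dimensional. The second argument enters through `σ`, so the radical is
the image of this kernel under the involution `σ`. -/
theorem exists_radical {H : Matrix (Fin (n + 1)) (Fin (n + 1)) L} {σ : L →+* L}
    (hσ : ∀ a, σ a = a ^ q) (hσσ : ∀ a, σ (σ a) = a) (hrank : H.rank = n) :
    ∃ r : Fin (n + 1) → L, r ≠ 0 ∧ (∀ x, sesqForm q H x r = 0) ∧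
      ∀ y, (∀ x, sesqForm q H x y = 0) → y ∈ span L {r} := by
  have h1 := H.mulVecLin.finrank_range_add_finrank_ker
  have h2 : Module.finrank L (LinearMap.range H.mulVecLin) = n := hrank
  rw [h2, Module.finrank_fin_fun, add_right_inj] at h1
  obtain ⟨⟨z, hz⟩, hz0, hspan⟩ := finrank_eq_one_iff'.1 h1
  rw [LinearMap.mem_ker, Matrix.mulVecLin_apply] at hz
  refine ⟨fun i => σ (z i), ?_, ?_, ?_⟩
  · intro h
    apply hz0
    ext i
    exact (map_eq_zero σ).1 (congr_fun h i)
  · rw [forall_sesqForm_eq_zero_iff]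
    simpa only [← hσ, hσσ] using hz
  · intro y hy
    rw [forall_sesqForm_eq_zero_iff] at hy
    obtain ⟨c, hc⟩ := hspan ⟨_, LinearMap.mem_ker.2 hy⟩
    refine mem_span_singleton.2 ⟨σ c, ?_⟩
    funext i
    have := congr_fun (congr_arg Subtype.val hc) i
    simp only [SetLike.val_smul, Pi.smul_apply, smul_eq_mul, ← hσ] at this
    rw [Pi.smul_apply, smul_eq_mul, ← map_mul, this, hσσ]

/-- Coordinates in which a Hermitian form of rank `3` on `L ^ 4` has the equation
`y z ^ q + y ^ q z + β x ^ (q + 1) + γ z ^ (q + 1)`. -/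
theorem exists_hermitian_basis {H : Matrix (Fin (3 + 1)) (Fin (3 + 1)) L} {σ : L →+* L}
    (hσ : ∀ a, σ a = a ^ q) (hσσ : ∀ a, σ (σ a) = a)
    (hH : H.transpose = H.map (fun a => a ^ q))
    {r v : Fin (3 + 1) → L} (hr0 : r ≠ 0) (hr : ∀ x, sesqForm q H x r = 0)
    (hrad : ∀ y, (∀ x, sesqForm q H x y = 0) → y ∈ span L {r})
    (hv : sesqForm q H v v = 0) (hvr : v ∉ span L {r}) :
    ∃ (b : Module.Basis (Fin (3 + 1)) L (Fin (3 + 1) → L)) (β γ : L), β ≠ 0 ∧ b 0 = r ∧ b 1 = v ∧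
      ∀ t y x z : L, sesqForm q H (t • b 0 + y • b 1 + x • b 2 + z • b 3)
        (t • b 0 + y • b 1 + x • b 2 + z • b 3) =
          y * z ^ q + y ^ q * z + β * x ^ (q + 1) + γ * z ^ (q + 1) := by
  have hq0 : q ≠ 0 := by
    rintro rfl
    have := hσ 0
    simp at this
  have swap0 : ∀ x y, sesqForm q H x y = 0 → sesqForm q H y x = 0 := fun x y h => by
    rw [sesqForm_swap hσ hσσ hH x y, h, zero_pow hq0]
  obtain ⟨w, hw⟩ : ∃ w, sesqForm q H w v = 1 := by
    by_contra hcon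
    push Not at hcon
    refine hvr (hrad v fun x => ?_)
    by_contra hx
    exact hcon ((sesqForm q H x v)⁻¹ • x) (by rw [sesqForm_smul_left, inv_mul_cancel₀ hx])
  have hw' : sesqForm q H v w = 1 := by rw [sesqForm_swap hσ hσσ hH w v, hw, one_pow]
  obtain ⟨u, huv, huw, hur⟩ : ∃ u, sesqForm q H u v = 0 ∧ sesqForm q H u w = 0 ∧
      u ∉ span L {r} := by
    -- The common orthogonal of `v` and `w` has dimension at least `4 - 2 = 2`, so it is not
    -- contained in the line spanned by `r`.
    let φ : (Fin (3 + 1) → L) →ₗ[L] L × L :=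
      { toFun := fun x => (sesqForm q H x v, sesqForm q H x w)
        map_add' := fun x y => by simp [sesqForm_add_left]
        map_smul' := fun c x => by simp [sesqForm_smul_left] }
    by_contra hcon
    push Not at hcon
    have hle : LinearMap.ker φ ≤ span L {r} := fun x hx => by
      have hx' := LinearMap.mem_ker.1 hx
      exact hcon x (congr_arg Prod.fst hx') (congr_arg Prod.snd hx')
    have h1 := Submodule.finrank_mono hle
    have h2 := finrank_span_singleton (K := L) hr0
    have h3 := φ.finrank_range_add_finrank_ker
    have h4 := Submodule.finrank_le (LinearMap.range φ)
    rw [Module.finrank_prod, Module.finrank_self] at h4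
    rw [Module.finrank_fin_fun] at h3
    omega
  have hvu := swap0 _ _ huv
  have hwu := swap0 _ _ huw
  have hli : LinearIndependent L ![r, v, u, w] := by
    rw [Fintype.linearIndependent_iff]
    intro g hg
    simp only [Fin.sum_univ_four, Matrix.cons_val] at hg
    have e1 := congr_arg (fun x => sesqForm q H x v) hg
    have e2 := congr_arg (fun x => sesqForm q H x w) hg
    have z1 : ∀ y, sesqForm q H 0 y = 0 := fun y => by simp [sesqForm]
    simp only [sesqForm_add_left, sesqForm_smul_left, swap0 _ _ (hr _), hv, huv, huw, hw, hw',
      z1] at e1 e2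
    have g3 : g 3 = 0 := by simpa using e1
    have g1 : g 1 = 0 := by simpa [g3] using e2
    simp only [g1, g3, zero_smul, add_zero] at hg
    have g2 : g 2 = 0 := by
      by_contra h
      refine hur (mem_span_singleton.2 ⟨-((g 2)⁻¹ * g 0), ?_⟩)
      have : g 0 • r = -(g 2 • u) := eq_neg_of_add_eq_zero_left hg
      rw [neg_smul, mul_smul, this, smul_neg, neg_neg, smul_smul, inv_mul_cancel₀ h, one_smul]
    have g0 : g 0 = 0 := by
      rw [g2, zero_smul, add_zero] at hg
      exact (smul_eq_zero.1 hg).resolve_right hr0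
    intro i
    fin_cases i <;> assumption
  let b := basisOfLinearIndependentOfCardEqFinrank hli (by simp)
  have hb : ⇑b = ![r, v, u, w] := coe_basisOfLinearIndependentOfCardEqFinrank _ _
  have hb0 : b 0 = r := by simp [hb]
  have hb1 : b 1 = v := by simp [hb]
  have hb2 : b 2 = u := by simp [hb]
  have hb3 : b 3 = w := by simp [hb]
  refine ⟨b, sesqForm q H u u, sesqForm q H w w, ?_, hb0, hb1, ?_⟩
  -- If `u` were isotropic, it would be orthogonal to all of `r, v, u, w` and so lie in the radical.
  · intro hβ
    refine hur (hrad u fun x => ?_)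
    rw [← b.sum_repr x, Fin.sum_univ_four, hb0, hb1, hb2, hb3]
    simp only [sesqForm_add_left, sesqForm_smul_left, swap0 _ _ (hr _), hvu, hwu, hβ]
    ring
  · intro t y x z
    rw [hb0, hb1, hb2, hb3]
    simp only [sesqForm_add_left, sesqForm_smul_left, sesqForm_add_right hσ, sesqForm_smul_right,
      swap0 _ _ (hr _), hr, hv, huv, huw, hw, hw', hvu, hwu]
    ring

end Form

/-! ### Lines on the Hermitian cone -/

theorem aeval_hermitianPoly {K : Type*} [Field K] {n q : ℕ}
    (H : Matrix (Fin (n + 1)) (Fin (n + 1)) K) (L : Type*) [Field L] [Algebra K L]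
    (x : Fin (n + 1) → L) :
    MvPolynomial.aeval x (hermitianPoly q H) = sesqForm q (H.map (algebraMap K L)) x x := by
  simp [hermitianPoly, sesqForm]

theorem aeval_hermitianPoly_self {K : Type*} [Field K] {n q : ℕ}
    (H : Matrix (Fin (n + 1)) (Fin (n + 1)) K) (x : Fin (n + 1) → K) :
    MvPolynomial.aeval x (hermitianPoly q H) = sesqForm q H x x := by
  simp [hermitianPoly, sesqForm]

theorem sesqForm_map {K : Type*} [Field K] {n q : ℕ}
    (H : Matrix (Fin n) (Fin n) K) (L : Type*) [Field L] [Algebra K L] (x y : Fin n → K) :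
    sesqForm q (H.map (algebraMap K L)) (fun i => algebraMap K L (x i))
      (fun i => algebraMap K L (y i)) = algebraMap K L (sesqForm q H x y) := by
  simp [sesqForm]

theorem hermitianPoly_isHomogeneous {K : Type*} [Field K] {n q : ℕ}
    (H : Matrix (Fin (n + 1)) (Fin (n + 1)) K) : (hermitianPoly q H).IsHomogeneous (q + 1) := by
  refine MvPolynomial.IsHomogeneous.sum _ _ _ fun i _ =>
    MvPolynomial.IsHomogeneous.sum _ _ _ fun j _ => ?_
  have h := ((MvPolynomial.isHomogeneous_C (Fin (n + 1)) (H i j)).mul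
    (MvPolynomial.isHomogeneous_X K i)).mul ((MvPolynomial.isHomogeneous_X K j).pow q)
  convert h using 1
  ring

theorem mk_mem_linearPoints_iff {K : Type*} [Field K] {n : ℕ}
    (W : Submodule K (Fin (n + 1) → K)) (v : Fin (n + 1) → K) (hv : v ≠ 0) :
    Projectivization.mk K v hv ∈ linearPoints W K ↔ v ∈ W := by
  obtain ⟨a, ha⟩ := Projectivization.exists_smul_eq_mk_rep K v hv
  rw [mem_linearPoints_self_iff, ← ha]
  exact W.smul_mem_iff a.ne_zero

theorem sesqForm_eq_zero_of_isLineOf {K : Type*} [Field K] {n q : ℕ}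
    {H : Matrix (Fin (n + 1)) (Fin (n + 1)) K} {W : Submodule K (Fin (n + 1) → K)}
    (hW : IsLineOf (hermitianPoly q H) W) {w : Fin (n + 1) → K} (hw : w ∈ W) :
    sesqForm q H w w = 0 := by
  by_cases hw0 : w = 0
  · simp [hw0, sesqForm]
  let L := AlgebraicClosure K
  have hinj : Function.Injective (algebraMap K L) := (algebraMap K L).injective
  have hne : (fun i => algebraMap K L (w i)) ≠ 0 := fun h => hw0 <| by
    funext i
    exact (map_eq_zero _).1 (congr_fun h i)
  have hmem : Projectivization.mk L _ hne ∈ linearPoints W L := by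
    obtain ⟨a, ha⟩ := Projectivization.exists_smul_eq_mk_rep L _ hne
    rw [linearPoints, Set.mem_ofPred_eq, ← ha]
    exact smul_mem _ _ (subset_span ⟨w, hw, rfl⟩)
  have := (mk_mem_zeroLocus_iff (hermitianPoly_isHomogeneous H) L _ hne).1 (hW.2 hmem)
  rw [aeval_hermitianPoly, sesqForm_map] at this
  exact (map_eq_zero _).1 this

theorem finrank_span_pair {K V : Type*} [Field K] [AddCommGroup V] [Module K V] {r s : V}
    (hr : r ≠ 0) (hs : s ∉ span K {r}) : Module.finrank K (span K {r, s}) = 2 := by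
  have h : LinearIndependent K ![r, s] :=
    (LinearIndependent.pair_iff' hr).2 fun a ha => hs (mem_span_singleton.2 ⟨a, ha⟩)
  rw [← Matrix.range_cons_cons_empty, finrank_span_eq_card h, Fintype.card_fin]

/-- Over the algebraic closure `a ↦ a^q` is still additive, though no longer an involution.
Biadditivity therefore reduces vanishing at geometric points to the four values on `r` and `s`. -/
theorem isLineOf_span_pair {K : Type*} [Field K] [Finite K] {n q : ℕ} (hq : Nat.card K = q ^ 2)
    {H : Matrix (Fin (n + 1)) (Fin (n + 1)) K} {r s : Fin (n + 1) → K} (hr0 : r ≠ 0)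
    (hs : s ∉ span K {r}) (hrr : sesqForm q H r r = 0) (hrs : sesqForm q H r s = 0)
    (hsr : sesqForm q H s r = 0) (hss : sesqForm q H s s = 0) :
    IsLineOf (hermitianPoly q H) (span K {r, s}) := by
  refine ⟨finrank_span_pair hr0 hs, fun p hp => ?_⟩
  obtain ⟨σ, hσ⟩ := exists_powHom hq (AlgebraicClosure K)
  let ι : (Fin (n + 1) → K) → Fin (n + 1) → AlgebraicClosure K := fun w i => algebraMap K (AlgebraicClosure K) (w i)
  have hp' : p.rep ∈ span (AlgebraicClosure K) {ι r, ι s} := by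
    refine (span_le.2 ?_ : span (AlgebraicClosure K) (ι '' (span K {r, s} : Set _))
      ≤ span (AlgebraicClosure K) {ι r, ι s}) hp
    rintro _ ⟨w, hw, rfl⟩
    obtain ⟨a, b, rfl⟩ := mem_span_pair.1 hw
    refine mem_span_pair.2 ⟨algebraMap K (AlgebraicClosure K) a,
      algebraMap K (AlgebraicClosure K) b, ?_⟩
    funext i
    simp only [ι, Pi.add_apply, Pi.smul_apply, smul_eq_mul, map_add, map_mul]
  obtain ⟨a, b, hab⟩ := mem_span_pair.1 hp'
  rw [zeroLocus, Set.mem_ofPred_eq, aeval_hermitianPoly, ← hab]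
  have hι : ∀ x y, sesqForm q (H.map (algebraMap K (AlgebraicClosure K))) (ι x) (ι y)
      = algebraMap K (AlgebraicClosure K) (sesqForm q H x y) := sesqForm_map H (AlgebraicClosure K)
  simp [sesqForm_add_left, sesqForm_smul_left, sesqForm_add_right hσ, sesqForm_smul_right, hι,
    hrr, hrs, hsr, hss]

/-- A line on the cone missing the vertex would give a line of isotropic vectors `w + y v`. In
coordinates adapted to `v`, this makes a polynomial of degree `q` in `y` vanish at all `q^2`
elements of `K`. -/
theorem mem_of_isLineOf {K : Type*} [Field K] [Finite K] {q : ℕ} (hq : Nat.card K = q ^ 2)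
    (hq2 : 2 ≤ q) {H : Matrix (Fin (3 + 1)) (Fin (3 + 1)) K} {σ : K →+* K}
    (hσ : ∀ a, σ a = a ^ q) (hσσ : ∀ a, σ (σ a) = a)
    (hH : H.transpose = H.map (fun a => a ^ q)) {r : Fin (3 + 1) → K}
    (hr0 : r ≠ 0) (hr : ∀ x, sesqForm q H x r = 0)
    (hrad : ∀ y, (∀ x, sesqForm q H x y = 0) → y ∈ span K {r})
    {W : Submodule K (Fin (3 + 1) → K)} (hW : IsLineOf (hermitianPoly q H) W) : r ∈ W := by
  classical
  have := Fintype.ofFinite K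
  by_contra hrW
  have hWne : W ≠ ⊥ := by
    rintro rfl
    simpa using hW.1
  obtain ⟨v, hvW, hv0⟩ := W.ne_bot_iff.1 hWne
  have hvr : v ∉ span K {r} := by
    rintro hv
    obtain ⟨a, rfl⟩ := mem_span_singleton.1 hv
    exact hrW ((W.smul_mem_iff (left_ne_zero_of_smul hv0)).1 hvW)
  obtain ⟨b, β, γ, hβ, hb0, hb1, hform⟩ := exists_hermitian_basis hσ hσσ hH hr0 hr hrad
    (sesqForm_eq_zero_of_isLineOf hW hvW) hvr
  obtain ⟨w, hwW, hwv⟩ : ∃ w ∈ W, w ∉ span K {v} := by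
    by_contra hcon
    push Not at hcon
    have h1 := Submodule.finrank_mono (show W ≤ span K {v} from hcon)
    rw [hW.1, finrank_span_singleton hv0] at h1
    omega
  obtain ⟨c, hc⟩ : ∃ c : Fin (3 + 1) → K, w = c 0 • b 0 + c 1 • b 1 + c 2 • b 2 + c 3 • b 3 :=
    ⟨b.repr w, by rw [← Fin.sum_univ_four (fun i => b.repr w i • b i), b.sum_repr]⟩
  have hiso : ∀ y, (c 1 + y) * c 3 ^ q + (c 1 + y) ^ q * c 3 + β * c 2 ^ (q + 1)
      + γ * c 3 ^ (q + 1) = 0 := by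
    intro y
    rw [← hform (c 0)]
    have : c 0 • b 0 + (c 1 + y) • b 1 + c 2 • b 2 + c 3 • b 3 = w + y • v := by
      rw [hc, hb1]; module
    rw [this]
    exact sesqForm_eq_zero_of_isLineOf hW (W.add_mem hwW (W.smul_mem _ hvW))
  have hq0 : q ≠ 0 := by omega
  -- If `c 3 = 0`, the equation forces `c 2 = 0`, so `w` lies in the span of `r` and `v`; then
  -- either `r ∈ W` or `w` is a multiple of `v`.
  by_cases h3 : c 3 = 0
  · have h2 : c 2 = 0 := by
      have := hiso 0
      simpa [h3, hq0, hβ] using this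
    have h0 : c 0 = 0 := by
      by_contra h0
      apply hrW
      rw [h2, h3, zero_smul, zero_smul, add_zero, add_zero, hb0, hb1] at hc
      rw [← W.smul_mem_iff h0, ← add_sub_cancel_right (c 0 • r) (c 1 • v), ← hc]
      exact W.sub_mem hwW (W.smul_mem _ hvW)
    apply hwv
    rw [hc, h0, h2, h3, hb1]
    simpa using smul_mem _ _ (mem_span_singleton_self v)
  · have hall : (Finset.univ.filter fun y : K => y + y ^ q + (β * c 2 ^ (q + 1)
        + γ * c 3 ^ (q + 1)) / c 3 ^ (q + 1) = 0) = Finset.univ := by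
      rw [Finset.filter_eq_self]
      intro y _
      -- This substitution turns the equation into `c 3 ^ (q + 1)` times the normalized `y + y^q +
      -- const`.
      have := hiso (c 3 * y - c 1)
      rw [add_sub_cancel] at this
      field_simp
      linear_combination this
    have hle := card_pow_add_eq_zero_le hq2 ((β * c 2 ^ (q + 1)
        + γ * c 3 ^ (q + 1)) / c 3 ^ (q + 1))
    rw [hall, Finset.card_univ, ← Nat.card_eq_fintype_card, hq] at hle
    nlinarith

/-! ### Counting points on lines through the vertex -/

theorem ncard_linearPoints_diff {K : Type*} [Field K] [Finite K] {n : ℕ}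
    {W : Submodule K (Fin (n + 1) → K)} (hW : Module.finrank K W = 2) {r : Fin (n + 1) → K}
    (hr0 : r ≠ 0) (hr : r ∈ W) :
    (linearPoints W K \ {Projectivization.mk K r hr0}).ncard = Nat.card K := by
  obtain ⟨s, hsW, hsr⟩ : ∃ s ∈ W, s ∉ span K {r} := by
    by_contra hcon
    push Not at hcon
    have h1 := Submodule.finrank_mono (show W ≤ span K {r} from hcon)
    rw [hW, finrank_span_singleton hr0] at h1
    omega
  have hspan : span K {r, s} = W := Submodule.eq_of_le_of_finrank_eq
    (span_le.2 (Set.insert_subset hr (Set.singleton_subset_iff.2 hsW)))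
    (by rw [finrank_span_pair hr0 hsr, hW])
  have hnr : ∀ t : K, s + t • r ∉ span K {r} := fun t h => hsr <|
    (Submodule.add_mem_iff_left _ (smul_mem _ t (mem_span_singleton_self r))).1 h
  have hne : ∀ t : K, s + t • r ≠ 0 := fun t h => hnr t (h ▸ zero_mem _)
  -- Off `r`, the line is an affine line parametrized by `t ↦ s + t r`.
  have himg : linearPoints W K \ {Projectivization.mk K r hr0}
      = (fun t => Projectivization.mk K (s + t • r) (hne t)) '' Set.univ := by
    ext p
    induction p using Projectivization.ind with
    | h v hv =>
    simp only [Set.mem_sdiff, mk_mem_linearPoints_iff, Set.mem_singleton_iff, Set.image_univ,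
      Set.mem_range, Projectivization.mk_eq_mk_iff']
    constructor
    · rintro ⟨hvW, hvr⟩
      rw [← hspan] at hvW
      obtain ⟨a, b, rfl⟩ := mem_span_pair.1 hvW
      have hb : b ≠ 0 := by
        rintro rfl
        exact hvr ⟨a, by simp⟩
      refine ⟨b⁻¹ * a, b⁻¹, ?_⟩
      rw [smul_add, smul_smul, smul_smul, inv_mul_cancel₀ hb, one_smul, add_comm s]
    · rintro ⟨t, a, hta⟩
      have ha : a ≠ 0 := by
        rintro rfl
        exact hne t (by rw [← hta, zero_smul])
      refine ⟨(W.smul_mem_iff ha).1 (hta ▸ W.add_mem hsW (W.smul_mem _ hr)), ?_⟩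
      rintro ⟨c, rfl⟩
      exact hnr t (hta ▸ smul_mem _ _ (smul_mem _ _ (mem_span_singleton_self r)))
  rw [himg, Set.ncard_image_of_injective, Set.ncard_univ]
  intro t t' h
  obtain ⟨a, ha⟩ := (Projectivization.mk_eq_mk_iff' _ _ _ _ _).1 h
  have h1 : (a - 1) • s = (t - a * t') • r := by
    rw [← sub_eq_zero] at ha ⊢
    rw [← ha]
    module
  have ha1 : a = 1 := by
    by_contra hne1
    apply hsr
    rw [← (span K {r}).smul_mem_iff (sub_ne_zero.2 hne1), h1]
    exact smul_mem _ _ (mem_span_singleton_self r)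
  rw [ha1, sub_self, zero_smul, one_mul] at h1
  exact sub_eq_zero.1 ((smul_eq_zero.1 h1.symm).resolve_right hr0)

/-- The number of rational points of a union of lines through a common point. -/
theorem ncard_biUnion_linearPoints {K : Type*} [Field K] [Finite K] {n : ℕ}
    {S : Finset (Submodule K (Fin (n + 1) → K))} (hS : S.Nonempty) {r : Fin (n + 1) → K}
    (hr0 : r ≠ 0) (hdim : ∀ W ∈ S, Module.finrank K W = 2) (hmem : ∀ W ∈ S, r ∈ W) :
    (⋃ W ∈ S, linearPoints W K).ncard = 1 + Nat.card K * S.card := by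
  classical
  set P := Projectivization.mk K r hr0
  have hP : P ∈ ⋃ W ∈ S, linearPoints W K := by
    obtain ⟨W, hW⟩ := hS
    exact Set.mem_biUnion hW ((mk_mem_linearPoints_iff W r hr0).2 (hmem W hW))
  have hdiff : (⋃ W ∈ S, linearPoints W K) \ {P}
      = ⋃ W ∈ (S : Set (Submodule K (Fin (n + 1) → K))), (linearPoints W K \ {P}) := by
    ext p
    simp only [Set.mem_sdiff, Set.mem_iUnion, Finset.mem_coe, exists_prop]
    tauto
  have hdisj : (S : Set (Submodule K (Fin (n + 1) → K))).PairwiseDisjoint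
      fun W => linearPoints W K \ {P} := by
    intro W hW W' hW' hne
    refine Set.disjoint_left.2 fun p hp hp' => hne ?_
    induction p using Projectivization.ind with
    | h v hv =>
    have hvr : v ∉ span K {r} := fun h => hp.2 <| by
      obtain ⟨a, rfl⟩ := mem_span_singleton.1 h
      exact (Projectivization.mk_eq_mk_iff' _ _ _ _ _).2 ⟨a, rfl⟩
    have key : ∀ W ∈ S, v ∈ W → span K {r, v} = W := fun W hW hvW =>
      Submodule.eq_of_le_of_finrank_eq
        (span_le.2 (Set.insert_subset (hmem W hW) (Set.singleton_subset_iff.2 hvW)))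
        (by rw [finrank_span_pair hr0 hvr, hdim W hW])
    rw [← key W hW ((mk_mem_linearPoints_iff _ _ _).1 hp.1),
      key W' hW' ((mk_mem_linearPoints_iff _ _ _).1 hp'.1)]
  rw [← Set.ncard_sdiff_singleton_add_one hP (Set.toFinite _), hdiff,
    Set.Finite.ncard_biUnion S.finite_toSet (fun _ _ => Set.toFinite _) hdisj,
    finsum_mem_coe_finset, Finset.sum_congr rfl fun W hW =>
      ncard_linearPoints_diff (hdim W hW) hr0 (hmem W hW), Finset.sum_const, smul_eq_mul, mul_comm,
    add_comm]

/-! ### Extremal surfaces are cones -/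

theorem eval_smul_of_isHomogeneous {R ι : Type*} [CommSemiring R] {F : MvPolynomial ι R} {d : ℕ}
    (hF : F.IsHomogeneous d) (c : R) (x : ι → R) :
    MvPolynomial.eval (c • x) F = c ^ d * MvPolynomial.eval x F := by
  rw [MvPolynomial.eval_eq, MvPolynomial.eval_eq, Finset.mul_sum]
  refine Finset.sum_congr rfl fun m hm => ?_
  have hdeg : ∑ i ∈ m.support, m i = d := (hF.degree_eq_sum_deg_support hm).symm
  simp only [Pi.smul_apply, smul_eq_mul, mul_pow, Finset.prod_mul_distrib,
    Finset.prod_pow_eq_pow_sum, hdeg]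
  ring

/-- A surface of degree at most `q` that attains the maximal number of rational points on the
Hermitian cone is itself a cone with the same vertex. -/
theorem eval_add_smul_eq_of_ncard_eq {K : Type*} [Field K] [Finite K] {q d : ℕ}
    (hq : Nat.card K = q ^ 2) (hq2 : 2 ≤ q) {H : Matrix (Fin (3 + 1)) (Fin (3 + 1)) K}
    {σ : K →+* K} (hσ : ∀ a, σ a = a ^ q) (hσσ : ∀ a, σ (σ a) = a)
    (hH : H.transpose = H.map (fun a => a ^ q)) {r : Fin (3 + 1) → K}
    (hr0 : r ≠ 0) (hr : ∀ x, sesqForm q H x r = 0)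
    (hrad : ∀ y, (∀ x, sesqForm q H x y = 0) → y ∈ span K {r})
    (hd : 1 ≤ d) (hdq : d ≤ q)
    {F : MvPolynomial (Fin (3 + 1)) K} (hF0 : F ≠ 0) (hF : F.IsHomogeneous d)
    (hcard : (zeroLocus (hermitianPoly q H) K ∩ zeroLocus F K).ncard
      = 1 + q ^ 2 * (d * (q + 1))) (a : K) (x : Fin (3 + 1) → K) :
    MvPolynomial.eval (x + a • r) F = MvPolynomial.eval x F := by
  classical
  have := Fintype.ofFinite K
  set V := zeroLocus (hermitianPoly q H) K ∩ zeroLocus F K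
  have hmemV : ∀ (w : Fin (3 + 1) → K) (hw : w ≠ 0), Projectivization.mk K w hw ∈ V ↔
      sesqForm q H w w = 0 ∧ MvPolynomial.eval w F = 0 := by
    intro w hw
    rw [Set.mem_inter_iff, mk_mem_zeroLocus_iff (hermitianPoly_isHomogeneous H),
      mk_mem_zeroLocus_iff hF, aeval_hermitianPoly_self, MvPolynomial.aeval_eq_eval]
  set P := Projectivization.mk K r hr0
  obtain ⟨v, hv, hvr⟩ : ∃ v, sesqForm q H v v = 0 ∧ v ∉ span K {r} := by
    have h1 : 1 < V.ncard := by
      rw [hcard]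
      have : 0 < q ^ 2 * (d * (q + 1)) := by positivity
      omega
    obtain ⟨p, hp, hpP⟩ := Set.exists_ne_of_one_lt_ncard h1 P
    induction p using Projectivization.ind with
    | h v hv0 =>
    refine ⟨v, ((hmemV v hv0).1 hp).1, fun h => hpP ?_⟩
    obtain ⟨a, rfl⟩ := mem_span_singleton.1 h
    exact (Projectivization.mk_eq_mk_iff' _ _ _ _ _).2 ⟨a, rfl⟩
  obtain ⟨b, β, γ, hβ, hb0, hb1, hform⟩ := exists_hermitian_basis hσ hσσ hH hr0 hr hrad hv hvr
  let F' : MvPolynomial (Fin (3 + 1)) K := MvPolynomial.aeval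
    (fun i => ∑ j, MvPolynomial.C (b j i) * MvPolynomial.X j) F
  have heval : ∀ c : Fin (3 + 1) → K,
      MvPolynomial.eval c F' = MvPolynomial.eval (∑ j, c j • b j) F := by
    intro c
    have h := congr_arg (fun g : MvPolynomial (Fin (3 + 1)) K →ₐ[K] K => g F)
      (MvPolynomial.comp_aeval (fun i => ∑ j, MvPolynomial.C (b j i) * MvPolynomial.X j)
        (MvPolynomial.aeval c))
    simp only [AlgHom.comp_apply] at h
    rw [← MvPolynomial.coe_aeval_eq_eval, ← MvPolynomial.coe_aeval_eq_eval, RingHom.coe_coe,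
      RingHom.coe_coe, h]
    congr 2
    funext i
    simp [Finset.sum_apply, mul_comm]
  have hrepr : ∀ w, ∑ j, b.equivFun w j • b j = w := b.sum_equivFun
  have hF' : F'.IsHomogeneous d := by
    have := hF.aeval (fun i => ∑ j, MvPolynomial.C (b j i) * MvPolynomial.X j) (n := 1)
      fun i => MvPolynomial.IsHomogeneous.sum _ _ _ fun j _ =>
        MvPolynomial.isHomogeneous_C_mul_X _ _
    rwa [one_mul] at this
  -- The form `F` has degree `d ≤ q ≤ |K|`, so it cannot vanish at every vector of `K^4`; this
  -- avoids inverting the change of variables.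
  have hF'0 : F' ≠ 0 := by
    intro h
    refine hF0 (hF.eq_zero_of_forall_eval_eq_zero_of_le_card (fun w => ?_) ?_)
    · rw [← hrepr w, ← heval, h, map_zero]
    · rw [Cardinal.mk_fintype, ← Nat.card_eq_fintype_card, hq]
      exact_mod_cast hdq.trans (Nat.le_self_pow two_ne_zero q)
  -- The value `P` at the zero vector is only a default.
  let f : (Fin (3 + 1) → K) → Projectivization K (Fin (3 + 1) → K) := fun c =>
    if h : ∑ j, c j • b j = 0 then P else Projectivization.mk K _ h
  let A := Finset.univ.filter fun z : K × K × K =>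
    z.2.2 + z.2.2 ^ q + β * z.2.1 ^ (q + 1) + γ = 0
        ∧ MvPolynomial.eval (Fin.cons z.1 ![z.2.2, z.2.1, 1]) F' = 0
  let A' := Finset.univ.filter fun t : K => MvPolynomial.eval (Fin.cons t ![1, 0, 0]) F' = 0
  have hscale : ∀ (w : Fin (3 + 1) → K) (hw : w ≠ 0), Projectivization.mk K w hw ∈ V →
      ∀ e : K, e ≠ 0 → ∀ c : Fin (3 + 1) → K, c = b.equivFun (e • w) →
        sesqForm q H (∑ j, c j • b j) (∑ j, c j • b j) = 0 ∧ MvPolynomial.eval c F' = 0 ∧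
          f c = Projectivization.mk K w hw := by
    rintro w hw hwV e he _ rfl
    have hew : e • w ≠ 0 := smul_ne_zero he hw
    have hmk : Projectivization.mk K (e • w) hew = Projectivization.mk K w hw :=
      (Projectivization.mk_eq_mk_iff' _ _ _ _ _).2 ⟨e, rfl⟩
    rw [← hmk] at hwV ⊢
    obtain ⟨h1, h2⟩ := (hmemV _ _).1 hwV
    rw [heval]
    simp only [f, hrepr, hew, dite_false]
    exact ⟨h1, h2, trivial⟩
  -- Three kinds of points: the vertex, those over the affine curve (scaled to `c 3 = 1`), and those
  -- over its point at infinity (`c 3 = c 2 = 0`, scaled to `c 1 = 1`).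
  have hcover : V ⊆ ((({P} ∪ A.image fun z => f (Fin.cons z.1 ![z.2.2, z.2.1, 1])) ∪
      A'.image fun t => f (Fin.cons t ![1, 0, 0]) : Finset _) : Set _) := by
    intro p hp
    induction p using Projectivization.ind with
    | h w hw =>
    simp only [Finset.coe_union, Finset.coe_image, Finset.coe_singleton, Set.mem_union,
      Set.mem_singleton_iff, Set.mem_image, Finset.mem_coe, A, A', Finset.mem_filter,
      Finset.mem_univ, true_and]
    set c := b.equivFun w with hc
    have hce : ∀ e : K, b.equivFun (e • w) = e • c := fun e => by rw [map_smul]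
    by_cases h3 : c 3 = 0
    · have h2 : c 2 = 0 := by
        have h := (hscale w hw hp 1 one_ne_zero _ rfl).1
        rw [hce, one_smul, Fin.sum_univ_four, hform, h3] at h
        have hq0 : q ≠ 0 := by omega
        simpa [hq0, hβ] using h
      by_cases h1 : c 1 = 0
      · left; left
        refine (Projectivization.mk_eq_mk_iff' _ _ _ _ _).2 ⟨c 0, ?_⟩
        have h := hrepr w
        rw [← hc, Fin.sum_univ_four, h1, h2, h3, hb0] at h
        simpa using h
      · right
        have h := hscale w hw hp (c 1)⁻¹ (inv_ne_zero h1) (Fin.cons ((c 1)⁻¹ * c 0) ![1, 0, 0]) (by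
          rw [hce]
          funext i
          fin_cases i <;> simp [h1, h2, h3])
        exact ⟨_, h.2⟩
    · left; right
      have h := hscale w hw hp (c 3)⁻¹ (inv_ne_zero h3)
        (Fin.cons ((c 3)⁻¹ * c 0) ![(c 3)⁻¹ * c 1, (c 3)⁻¹ * c 2, 1]) (by
          rw [hce]
          funext i
          fin_cases i <;> simp [h3])
      refine ⟨((c 3)⁻¹ * c 0, (c 3)⁻¹ * c 2, (c 3)⁻¹ * c 1), ⟨?_, h.2.1⟩, h.2.2⟩
      have h1 := h.1
      rw [Fin.sum_univ_four, hform] at h1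
      change (c 3)⁻¹ * c 1 * 1 ^ q + ((c 3)⁻¹ * c 1) ^ q * 1 + β * ((c 3)⁻¹ * c 2) ^ (q + 1)
        + γ * 1 ^ (q + 1) = 0 at h1
      simpa only [one_pow, mul_one] using h1
  have hle : V.ncard ≤ 1 + A.card + A'.card := by
    refine (Set.ncard_le_ncard hcover (Set.toFinite _)).trans ?_
    rw [Set.ncard_coe_finset]
    refine (Finset.card_union_le _ _).trans (add_le_add ?_ Finset.card_image_le)
    exact (Finset.card_union_le _ _).trans
      (add_le_add (Finset.card_singleton _).le Finset.card_image_le)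
  rw [hcard] at hle
  have hcons := eval_cons_eq_of_card_le hq2 (Nat.card_eq_fintype_card.symm.trans hq) hdq hβ hF'0 hF'
    hle
  set c := b.equivFun x with hc
  -- Adding `a • r` changes only the vertex coordinate, which `F'` ignores.
  have h1 : ∑ j, (Fin.cons (c 0 + a) (Fin.tail c) : Fin (3 + 1) → K) j • b j = x + a • r := by
    rw [← hrepr x, ← hc, Fin.sum_univ_succ, Fin.sum_univ_succ (fun j => c j • b j), hb0]
    simp only [Fin.cons_zero, Fin.cons_succ, Fin.tail]
    module
  rw [← h1, ← heval, hcons, ← hcons (c 0), Fin.cons_self_tail, heval, hrepr]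

end HermitianCone

/-! ### The equivalence -/

theorem mainTheorem9 {K : Type*} [Field K] [Finite K] (q : ℕ) (hq : Nat.card K = q ^ 2)
    (H : Matrix (Fin (3 + 1)) (Fin (3 + 1)) K) (hH : HermitianCone.IsHermitianMatrix q H)
    (hrank : H.rank = 3)
    (d : ℕ) (hd : 1 ≤ d) (hdq : d ≤ q)
    (F : MvPolynomial (Fin (3 + 1)) K) (hF0 : F ≠ 0) (hF : F.IsHomogeneous d) :
    (HermitianCone.zeroLocus (HermitianCone.hermitianPoly q H) K ∩
        HermitianCone.zeroLocus F K).ncard = 1 + q ^ 2 * (d * (q + 1)) ↔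
      ∃ S : Finset (Submodule K (Fin (3 + 1) → K)),
        S.card = d * (q + 1) ∧
        (∀ W ∈ S, HermitianCone.IsLineOf (HermitianCone.hermitianPoly q H) W) ∧
        HermitianCone.zeroLocus (HermitianCone.hermitianPoly q H) K ∩
          HermitianCone.zeroLocus F K = ⋃ W ∈ S, HermitianCone.linearPoints W K := by
  open HermitianCone Submodule in
  classical
  have := Fintype.ofFinite K
  have hq2 : 2 ≤ q := by
    have h1 := Finite.one_lt_card (α := K)
    rw [hq] at h1
    by_contra h
    interval_cases q <;> simp at h1
  obtain ⟨σ, hσ⟩ := exists_powHom hq K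
  have hσσ : ∀ a, σ (σ a) = a := fun a => by
    rw [hσ, hσ, ← pow_mul, ← pow_two, ← hq, Nat.card_eq_fintype_card, FiniteField.pow_card]
  obtain ⟨r, hr0, hr, hrad⟩ := exists_radical hσ hσσ hrank
  have hr' : ∀ x, sesqForm q H r x = 0 := fun x => by
    rw [sesqForm_swap hσ hσσ hH.2 x r, hr, zero_pow (by omega)]
  have hmem : ∀ W, IsLineOf (hermitianPoly q H) W → r ∈ W := fun W hW =>
    mem_of_isLineOf hq hq2 hσ hσσ hH.2 hr0 hr hrad hW
  have hcount : ∀ S : Finset (Submodule K (Fin (3 + 1) → K)), S.Nonempty →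
      (∀ W ∈ S, IsLineOf (hermitianPoly q H) W) →
      (⋃ W ∈ S, linearPoints W K).ncard = 1 + q ^ 2 * S.card := fun S hS hline => by
    rw [ncard_biUnion_linearPoints hS hr0 (fun W hW => (hline W hW).1)
      (fun W hW => hmem W (hline W hW)), hq]
  have hpos : 0 < d * (q + 1) := by positivity
  constructor
  · intro hcard
    have hcone := eval_add_smul_eq_of_ncard_eq hq hq2 hσ hσσ hH.2 hr0 hr hrad hd hdq hF0 hF hcard
    set V := zeroLocus (hermitianPoly q H) K ∩ zeroLocus F K
    have hmemV : ∀ (w : Fin (3 + 1) → K) (hw : w ≠ 0), Projectivization.mk K w hw ∈ V ↔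
        sesqForm q H w w = 0 ∧ MvPolynomial.eval w F = 0 := by
      intro w hw
      rw [Set.mem_inter_iff, mk_mem_zeroLocus_iff (hermitianPoly_isHomogeneous H),
        mk_mem_zeroLocus_iff hF, aeval_hermitianPoly_self, MvPolynomial.aeval_eq_eval]
    set P := Projectivization.mk K r hr0
    -- All lines of the cone whose rational points lie in the intersection; their number is read off
    -- from the point count only at the end.
    let S : Finset (Submodule K (Fin (3 + 1) → K)) := (Set.toFinite
      {W | IsLineOf (hermitianPoly q H) W ∧ linearPoints W K ⊆ V}).toFinset
    have hS : ∀ W, W ∈ S ↔ IsLineOf (hermitianPoly q H) W ∧ linearPoints W K ⊆ V := fun W => by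
      simp [S]
    have hline : ∀ p ∈ V, p ≠ P → ∃ W ∈ S, p ∈ linearPoints W K := by
      intro p hp hpP
      induction p using Projectivization.ind with
      | h s hs0 =>
      obtain ⟨hss, hFs⟩ := (hmemV s hs0).1 hp
      have hsr : s ∉ span K {r} := fun h => hpP <| by
        obtain ⟨a, rfl⟩ := mem_span_singleton.1 h
        exact (Projectivization.mk_eq_mk_iff' _ _ _ _ _).2 ⟨a, rfl⟩
      have hl := isLineOf_span_pair hq hr0 hsr (hr r) (hr' s) (hr s) hss
      refine ⟨span K {r, s}, (hS _).2 ⟨hl, fun p hp => ?_⟩,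
        (mk_mem_linearPoints_iff _ _ _).2 (subset_span (by simp))⟩
      induction p using Projectivization.ind with
      | h w hw0 =>
      rw [mk_mem_linearPoints_iff] at hp
      refine (hmemV w hw0).2 ⟨sesqForm_eq_zero_of_isLineOf hl hp, ?_⟩
      obtain ⟨a, b, rfl⟩ := mem_span_pair.1 hp
      -- Invariance along `r` and homogeneity give `F(a r + b s) = b^d F(s) = 0`.
      rw [add_comm (a • r), hcone, eval_smul_of_isHomogeneous hF, hFs, mul_zero]
    have hex : ∃ p ∈ V, p ≠ P := by
      refine Set.exists_ne_of_one_lt_ncard ?_ P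
      rw [hcard]
      have : 0 < q ^ 2 * (d * (q + 1)) := by positivity
      omega
    obtain ⟨p₀, hp₀, hne₀⟩ := hex
    obtain ⟨W₀, hW₀, -⟩ := hline p₀ hp₀ hne₀
    have hunion : V = ⋃ W ∈ S, linearPoints W K := by
      refine Set.Subset.antisymm (fun p hp => ?_)
        (Set.iUnion₂_subset fun W hW => ((hS W).1 hW).2)
      by_cases hpP : p = P
      · rw [hpP]
        exact Set.mem_biUnion hW₀
          ((mk_mem_linearPoints_iff _ _ _).2 (hmem W₀ ((hS W₀).1 hW₀).1))
      · obtain ⟨W, hW, hpW⟩ := hline p hp hpP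
        exact Set.mem_biUnion hW hpW
    refine ⟨S, ?_, fun W hW => ((hS W).1 hW).1, hunion⟩
    rw [hunion, hcount S ⟨W₀, hW₀⟩ fun W hW => ((hS W).1 hW).1] at hcard
    have hqq : 0 < q ^ 2 := by positivity
    exact Nat.eq_of_mul_eq_mul_left hqq (Nat.add_left_cancel hcard)
  · rintro ⟨S, hScard, hline, hunion⟩
    rw [hunion, hcount S (Finset.card_pos.1 (by omega)) hline, hScard]
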